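/- Let $0<k<n$ be integers, let $I\subset\mathbb R$ be a non-trivial interval (an interval, open, closed or half-open, bounded or not, with more than one point), and let $f\colon I\to I$ be a continuous surjection with $$f^k(x)=\frac1{n+1}\sum_{i=0}^n f^i(x)\qquad\text{for all }x\in I,$$ where $f^i$ is the $i$-fold iterate of $f$ and $f^0=\mathrm{id}$. Consider the equation $$(n+1)r^k=\sum_{i=0}^n r^i \tag{C}$$ in a real unknown $r$. For $r_0>0$ say that $f$ is of the form $(P_{r_0})$ if there are $a\le b$ in the closure of $I$ in the extended real line $[-\infty,\infty]$, with $a\neq\infty$ and $b\neq-\infty$, such that for all $x\in I$ $$f(x)=\begin{cases} r_0(x-a)+a & \text{for } x\le a,\\ x & \text{for } x\in(a,b),\\ r_0(x-b)+b & \text{for } x\ge b\end{cases}$$ (if $a=-\infty$ the first piece is absent, and if $b=\infty$ the last piece is absent). Then: (i) If $k$ is odd and $n=2k$, then there is a constant $c\in\mathbb R$ with $f(x)=x+c$ for all $x\in I$. (ii) If $k$ is odd, $n$ is even and $n\ne 2k$, then (C) has exactly one positive root $r_0\neq1$, and $f$ is of the form $(P_{r_0})$. (iii) If $n$ is odd,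 then (C) has exactly one positive root $r_+\ne1$ and exactly one negative root $r_-$, and either there is a constant $c\in\mathbb R$ with $f(x)=r_-x+c$ for all $x\in I$, or $f$ is of the form $(P_{r_+})$. -/

import Mathlib

/-- `r` is a real root of the characteristic equation `(n+1) r^k = ∑_{i=0}^n r^i`. -/
def IsCharRoot (k n : ℕ) (r : ℝ) : Prop :=
  ((n : ℝ) + 1) * r ^ k = ∑ i ∈ Finset.range (n + 1), r ^ i

/-- `r` is the positive root different from `1` (there is exactly one, and it is `r`). -/
def IsThePosRoot (k n : ℕ) (r : ℝ) : Prop :=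
  ∀ s : ℝ, (0 < s ∧ s ≠ 1 ∧ IsCharRoot k n s) ↔ s = r

/-- `r` is the negative root (there is exactly one, and it is `r`). -/
def IsTheNegRoot (k n : ℕ) (r : ℝ) : Prop :=
  ∀ s : ℝ, (s < 0 ∧ IsCharRoot k n s) ↔ s = r

/-- `f` is the map with at most three affine pieces: slope `r` to the left of `a` (fixing `a`),
the identity on `(a, b)`, slope `r` to the right of `b` (fixing `b`). The break points lie in the
closure of `I` in the extended real line, so a piece may be absent (`a = -∞` or `b = ∞`). As
`a ≠ ∞` and `b ≠ -∞`, each of `a.toReal`, `b.toReal` is used only where `a`, `b` is finite. -/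
def IsThreePiece {I : Set ℝ} (f : I → I) (r : ℝ) : Prop :=
  ∃ a b : EReal,
    a ∈ closure ((fun x : ℝ => (x : EReal)) '' I) ∧
    b ∈ closure ((fun x : ℝ => (x : EReal)) '' I) ∧
    a ≤ b ∧ a ≠ ⊤ ∧ b ≠ ⊥ ∧
    ∀ x : I,
      (((x : ℝ) : EReal) ≤ a → (f x : ℝ) = r * ((x : ℝ) - a.toReal) + a.toReal) ∧
      (a < ((x : ℝ) : EReal) → ((x : ℝ) : EReal) < b → (f x : ℝ) = (x : ℝ)) ∧
      (b ≤ ((x : ℝ) : EReal) → (f x : ℝ) = r * ((x : ℝ) - b.toReal) + b.toReal)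

/-! The mean equation makes `f` injective, hence a strictly monotone bijection, and every two-sided
orbit solves the linear recurrence with characteristic polynomial p = `charPoly k n`.

If `f` is increasing, the differences along a non-fixed orbit have constant sign and are annihilated
by p/(X - 1) = `diffPoly k n`. The coefficients of this polynomial change sign once, so it is (X -
R)H with R its only positive root and H having nonnegative coefficients. A positive two-sided
solution t is then purely geometric (`succ_eq_mul_of_pos`): t_m / R^m has a constant weighted moving
sum, by H, and is a weighted average of its own translates, so a maximum principle at its supremum
makes it constant. Hence displacements are multiplied by R at each step, and R = 1 exactly when n =
2k. Since orbits keep their order for all positive and negative times, comparing their asymptotics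
gives a translation if R = 1 and three affine pieces otherwise.

If `f` is decreasing, orbits alternate around a fixed point ξ. Signs in the recurrence rule this out
for k odd and n even. For n odd, the sign-corrected sequence (-1)^m (x_m - ξ) is positive up to a
constant factor, and the same argument applied to `altPoly k n` shows that it is geometric. -/

section

open Polynomial Filter Topology

/-! ### Positive two-sided solutions of linear recurrences -/

/-- A solution of a first order linear recurrence on `ℤ` is a geometric sequence. -/
theorem eq_zpow_mul_of_succ_eq_mul {t : ℤ → ℝ} {R : ℝ} (hR : R ≠ 0)
    (h : ∀ m, t (m + 1) = R * t m) (m : ℤ) : t m = R ^ m * t 0 := by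
  induction m using Int.induction_on with
  | zero => simp
  | succ i ih => rw [h, ih, zpow_add_one₀ hR]; ring
  | pred i ih =>
    have h1 := h (-(i : ℤ) - 1)
    rw [sub_add_cancel, ih] at h1
    rw [zpow_sub_one₀ hR]
    field_simp
    linarith

/-- A nonnegative function on `ℤ` with a constant moving sum, whose value at each point is a
weighted average over a translated window charging two consecutive places, is constant. -/
theorem exists_eq_const_of_moving_sum {u : ℤ → ℝ} (hu : ∀ m, 0 ≤ u m)
    {N : ℕ} {h : ℕ → ℝ} (hh : ∀ i, 0 ≤ h i) {i₀ : ℕ} (hi₀ : i₀ < N) (hi₀' : 0 < h i₀) {W : ℝ}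
    (hW : ∀ m : ℤ, ∑ i ∈ Finset.range N, h i * u (m + i) = W)
    {N' : ℕ} {w : ℕ → ℝ} (hw : ∀ i, 0 ≤ w i) {j c : ℕ} (hj : j + 1 < N')
    (hwj : 0 < w j) (hwj' : 0 < w (j + 1))
    (havg : ∀ m : ℤ, ∑ i ∈ Finset.range N', w i * u (m + i) =
      (∑ i ∈ Finset.range N', w i) * u (m + c)) :
    ∃ M, ∀ m, u m = M := by
  have hbdd : BddAbove (Set.range u) := by
    refine ⟨W / h i₀, ?_⟩
    rintro _ ⟨m, rfl⟩
    rw [le_div_iff₀ hi₀', ← hW (m - i₀)]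
    calc u m * h i₀ = h i₀ * u (m - i₀ + i₀) := by rw [sub_add_cancel, mul_comm]
      _ ≤ _ := Finset.single_le_sum (f := fun i : ℕ => h i * u (m - i₀ + i))
          (fun i _ => mul_nonneg (hh i) (hu _)) (Finset.mem_range.2 hi₀)
  set M := sSup (Set.range u) with hM
  have huM : ∀ m, u m ≤ M := fun m => le_csSup hbdd ⟨m, rfl⟩
  -- The supremum need not be attained; `l` describes the indices along which `u` approaches it.
  set l : Filter ℤ := comap u (𝓝 M) with hl
  have hne : l.NeBot := comap_neBot_iff_frequently.2
    (mem_closure_iff_frequently.1 (csSup_mem_closure (Set.range_nonempty u) hbdd))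
  have hul : Tendsto u l (𝓝 M) := tendsto_comap
  have hstep : ∀ i < N', 0 < w i → Tendsto (fun m : ℤ => m + ((i : ℤ) - c)) l l := by
    intro i hi hwi
    rw [hl, tendsto_comap_iff, ← hl]
    set β := ∑ i ∈ Finset.range N', w i with hβ
    have hlow : Tendsto (fun m => M - β / w i * (M - u m)) l (𝓝 M) := by
      have := (tendsto_const_nhds (x := M)).sub
        (((tendsto_const_nhds (x := M)).sub hul).const_mul (β / w i))
      simpa using this
    refine tendsto_of_tendsto_of_tendsto_of_le_of_le hlow tendsto_const_nhds ?_ (fun m => huM _)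
    intro m
    have h1 : ∑ i ∈ Finset.range N', w i * (M - u (m - c + i)) = β * (M - u m) := by
      simp_rw [mul_sub, Finset.sum_sub_distrib]
      rw [havg (m - c), ← Finset.sum_mul, sub_add_cancel]
    have h2 : w i * (M - u (m - c + i)) ≤ β * (M - u m) := by
      rw [← h1]
      exact Finset.single_le_sum (f := fun i : ℕ => w i * (M - u (m - c + i)))
        (fun i _ => mul_nonneg (hw i) (sub_nonneg.2 (huM _))) (Finset.mem_range.2 hi)
    have h3 : M - u (m - c + i) ≤ β / w i * (M - u m) := by
      rw [div_mul_eq_mul_div, le_div_iff₀ hwi]; linarith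
    have h4 : m + ((i : ℤ) - c) = m - c + i := by ring
    simp only [Function.comp, h4]
    linarith
  -- Composing K translations by j - c or j + 1 - c reaches K + 1 consecutive offsets, so `u` is
  -- close to M on windows of any prescribed length.
  have hwindow : ∀ K i : ℕ, i ≤ K →
      Tendsto (fun m : ℤ => m + (K * ((j : ℤ) - c) + i)) l l := by
    intro K
    induction K with
    | zero =>
      intro i hi
      obtain rfl : i = 0 := by omega
      simp only [Nat.cast_zero, zero_mul, add_zero]
      exact tendsto_id
    | succ K ih =>
      intro i hi
      rcases i with _ | i
      · convert (hstep j (by omega) hwj).comp (ih 0 (by omega)) using 2 with m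
        simp only [Function.comp]; push_cast; ring
      · convert (hstep (j + 1) hj hwj').comp (ih i (by omega)) using 2 with m
        simp only [Function.comp]; push_cast; ring
  -- The moving sum over such a window tends to its value for the constant M, yet it is always W.
  -- This extremal value leaves no room for a deficit anywhere.
  have hWM : W = ∑ i ∈ Finset.range N, h i * M := by
    have h1 : Tendsto (fun m : ℤ => ∑ i ∈ Finset.range N, h i * u (m + (N * ((j : ℤ) - c) + i))) l
        (𝓝 (∑ i ∈ Finset.range N, h i * M)) :=
      tendsto_finsetSum _ fun i hi =>
        (hul.comp (hwindow N i (Finset.mem_range.1 hi).le)).const_mul (h i)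
    have h2 : (fun m : ℤ => ∑ i ∈ Finset.range N, h i * u (m + (N * ((j : ℤ) - c) + i))) =
        fun _ => W := by
      funext m
      rw [← hW (m + N * ((j : ℤ) - c))]
      simp_rw [add_assoc]
    rw [h2] at h1
    exact tendsto_nhds_unique tendsto_const_nhds h1
  refine ⟨M, fun m => ?_⟩
  have h1 : ∑ i ∈ Finset.range N, h i * (M - u (m - i₀ + i)) = 0 := by
    simp_rw [mul_sub, Finset.sum_sub_distrib]
    rw [hW, ← hWM, sub_self]
  have h2 := (Finset.sum_eq_zero_iff_of_nonneg
    (fun i _ => mul_nonneg (hh i) (sub_nonneg.2 (huM _)))).1 h1 i₀ (Finset.mem_range.2 hi₀)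
  rw [sub_add_cancel] at h2
  rcases mul_eq_zero.1 h2 with h3 | h3 <;> linarith

/-- The shift operator on two-sided real sequences. -/
noncomputable def shift : Module.End ℝ (ℤ → ℝ) := LinearMap.funLeft ℝ ℝ (· + 1)

theorem shift_apply (t : ℤ → ℝ) (m : ℤ) : shift t m = t (m + 1) := rfl

theorem shift_pow_apply (j : ℕ) (t : ℤ → ℝ) (m : ℤ) : (shift ^ j) t m = t (m + j) := by
  induction j generalizing m with
  | zero => simp
  | succ j ih =>
    rw [pow_succ', Module.End.mul_apply, shift_apply, ih]
    congr 1
    push_cast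
    ring

theorem aeval_shift_apply (P : ℝ[X]) (t : ℤ → ℝ) (m : ℤ) :
    aeval shift P t m = ∑ i ∈ Finset.range (P.natDegree + 1), P.coeff i * t (m + i) := by
  rw [aeval_eq_sum_range, LinearMap.sum_apply, Finset.sum_apply]
  exact Finset.sum_congr rfl fun i _ => by
    rw [LinearMap.smul_apply, Pi.smul_apply, shift_pow_apply, smul_eq_mul]

/-- A positive two-sided solution of a linear recurrence with characteristic polynomial
`(X - R) * H`, `H ≥ 0`, is geometric, if it satisfies a suitable averaging relation. -/
theorem succ_eq_mul_of_pos {t : ℤ → ℝ} (ht : ∀ m, 0 < t m) {R : ℝ} (hR : 0 < R)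
    {H : ℝ[X]} (hH : ∀ j, 0 ≤ H.coeff j) (hH0 : H ≠ 0)
    (hann : aeval shift ((X - C R) * H) t = 0)
    {A : ℝ[X]} (hA : ∀ i, 0 ≤ A.coeff i) {α : ℝ} {j c : ℕ}
    (hAj : 0 < A.coeff j) (hAj' : 0 < A.coeff (j + 1))
    (hroot : A.eval R = α * R ^ c) (havg : ∀ m, aeval shift A t m = α * t (m + c)) (m : ℤ) :
    t (m + 1) = R * t m := by
  have hR0 := hR.ne'
  set u : ℤ → ℝ := fun m => t m / R ^ m with hu
  have htu : ∀ m, t m = u m * R ^ m := fun m => by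
    simp only [hu]; field_simp
  have hsum : ∀ (P : ℝ[X]) (m : ℤ), aeval shift P t m =
      R ^ m * ∑ i ∈ Finset.range (P.natDegree + 1), (P.coeff i * R ^ i) * u (m + i) := by
    intro P m
    rw [aeval_shift_apply, Finset.mul_sum]
    refine Finset.sum_congr rfl fun i _ => ?_
    rw [htu, zpow_add₀ hR0, zpow_natCast]; ring
  -- Applying H leaves a sequence annihilated by X - R; dividing by R^m turns this into a constant
  -- moving sum of `u`.
  have hHt : ∀ m, aeval shift H t (m + 1) = R * aeval shift H t m := by
    intro m
    have h1 := congrFun hann m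
    simp only [map_mul, map_sub, aeval_X, aeval_C, Module.End.mul_apply, LinearMap.sub_apply,
      Pi.sub_apply, shift_apply, Module.algebraMap_end_apply, Pi.smul_apply, smul_eq_mul,
      Pi.zero_apply] at h1
    linarith
  obtain ⟨M, hM⟩ := exists_eq_const_of_moving_sum (u := u)
    (fun m => (div_pos (ht m) (zpow_pos hR m)).le)
    (N := H.natDegree + 1) (h := fun i => H.coeff i * R ^ i)
    (fun i => mul_nonneg (hH i) (by positivity))
    (i₀ := H.natDegree) (by omega)
    (mul_pos (lt_of_le_of_ne (hH _) (Ne.symm (by simpa using hH0))) (by positivity))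
    (W := aeval shift H t 0)
    (fun m => by
      have h1 := eq_zpow_mul_of_succ_eq_mul hR0 hHt m
      rw [hsum] at h1
      exact mul_left_cancel₀ (zpow_pos hR m).ne' h1)
    (N' := A.natDegree + 1) (w := fun i => A.coeff i * R ^ i)
    (fun i => mul_nonneg (hA i) (by positivity))
    (j := j) (c := c)
    (by have := le_natDegree_of_ne_zero hAj'.ne'; omega)
    (by positivity) (by positivity)
    (fun m => by
      have h1 := havg m
      rw [hsum, htu (m + c), zpow_add₀ hR0, zpow_natCast] at h1
      rw [← eval_eq_sum_range, hroot]
      apply mul_left_cancel₀ (zpow_pos hR m).ne'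
      rw [h1]; ring)
  rw [htu, htu m, hM, hM, zpow_add_one₀ hR0]; ring

/-! ### Polynomials with one sign change -/

/-- If the coefficients of `F` change sign at most once, from `≤ 0` to `≥ 0`, then dividing out a
positive root leaves nonnegative coefficients. -/
theorem coeff_divByMonic_nonneg_of_sign_change {F : ℝ[X]} {s : ℕ}
    (hneg : ∀ i < s, F.coeff i ≤ 0) (hpos : ∀ i, s ≤ i → 0 ≤ F.coeff i)
    {R : ℝ} (hR : 0 < R) (hroot : F.IsRoot R) (j : ℕ) :
    0 ≤ (F /ₘ (X - C R)).coeff j := by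
  by_cases hj : s ≤ j + 1
  -- From the sign change on, a quotient coefficient is a sum of higher coefficients of `F` times
  -- powers of R. Below it, R h_{j+1} = h_j - F_{j+1} propagates nonnegativity upwards.
  · rw [coeff_divByMonic_X_sub_C]
    refine Finset.sum_nonneg fun i hi => mul_nonneg (by positivity) (hpos i ?_)
    rw [Finset.mem_Icc] at hi
    omega
  · have hF := mul_divByMonic_eq_iff_isRoot.2 hroot
    set H := F /ₘ (X - C R)
    induction j with
    | zero =>
      have h1 := hneg 0 (by omega)
      rw [← hF] at h1
      simp only [mul_coeff_zero, coeff_sub, coeff_X_zero, coeff_C_zero] at h1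
      nlinarith
    | succ j ih =>
      have h1 := hneg (j + 1) (by omega)
      have h2 := ih (by omega)
      rw [← hF, coeff_X_sub_C_mul] at h1
      nlinarith

theorem eval_pos_of_coeff_nonneg {H : ℝ[X]} (hH : ∀ j, 0 ≤ H.coeff j) (hH0 : H ≠ 0)
    {x : ℝ} (hx : 0 < x) : 0 < H.eval x := by
  rw [eval_eq_sum_range]
  refine Finset.sum_pos' (fun i _ => mul_nonneg (hH i) (by positivity))
    ⟨H.natDegree, by simp, mul_pos (lt_of_le_of_ne (hH _) (Ne.symm (by simpa using hH0)))
      (by positivity)⟩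

/-- A polynomial with exactly one sign change has exactly one positive root, and the cofactor of
that root has nonnegative coefficients. -/
theorem exists_factor_of_sign_change {F : ℝ[X]} {s : ℕ} (hneg : ∀ i < s, F.coeff i ≤ 0)
    (hpos : ∀ i, s ≤ i → 0 ≤ F.coeff i) (h0 : F.coeff 0 < 0) {d : ℕ} (hd : 0 < F.coeff d) :
    ∃ (R : ℝ) (H : ℝ[X]), 0 < R ∧ F = (X - C R) * H ∧ (∀ j, 0 ≤ H.coeff j) ∧ H ≠ 0 ∧
      ∀ x, 0 < x → (F.eval x = 0 ↔ x = R) := by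
  have hF0 : F ≠ 0 := by rintro rfl; simp at hd
  have hsd : s ≤ d := by
    by_contra h
    linarith [hneg d (by omega)]
  have hdpos : 0 < d := by
    rcases Nat.eq_zero_or_pos d with rfl | h
    · linarith
    · exact h
  have hdd : d ≤ F.natDegree := le_natDegree_of_ne_zero hd.ne'
  have htop := tendsto_atTop_of_leadingCoeff_nonneg F
    (natDegree_pos_iff_degree_pos.1 (by omega)) (hpos _ (by omega))
  obtain ⟨y, hy0, hy⟩ := ((eventually_ge_atTop 0).and (htop.eventually_ge_atTop 0)).exists
  have hF00 : F.eval 0 < 0 := by rwa [← coeff_zero_eq_eval_zero]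
  obtain ⟨R, ⟨hR0, -⟩, hR⟩ := intermediate_value_Icc hy0 F.continuous.continuousOn ⟨hF00.le, hy⟩
  have hRpos : 0 < R := lt_of_le_of_ne hR0 (by rintro rfl; exact hF00.ne hR)
  have hfac := mul_divByMonic_eq_iff_isRoot.2 (show F.IsRoot R from hR)
  have hH := coeff_divByMonic_nonneg_of_sign_change hneg hpos hRpos hR
  have hH0 : F /ₘ (X - C R) ≠ 0 := by
    intro h
    rw [h, mul_zero] at hfac
    exact hF0 hfac.symm
  refine ⟨R, F /ₘ (X - C R), hRpos, hfac.symm, hH, hH0, fun x hx => ⟨fun h => ?_, ?_⟩⟩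
  · rw [← hfac, eval_mul] at h
    rcases mul_eq_zero.1 h with h | h
    · simpa [sub_eq_zero] using h
    · exact absurd h (eval_pos_of_coeff_nonneg hH hH0 hx).ne'
  · rintro rfl; exact hR

end

section

open Polynomial Filter Topology

/-! ### The characteristic polynomial and its positive root -/

/-- The characteristic polynomial `∑_{i=0}^n X^i - (n+1) X^k`. -/
noncomputable def charPoly (k n : ℕ) : ℝ[X] :=
  ∑ i ∈ Finset.range (n + 1), X ^ i - C ((n : ℝ) + 1) * X ^ k

/-- The quotient of the characteristic polynomial by `X - 1`. -/
noncomputable def diffPoly (k n : ℕ) : ℝ[X] :=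
  ∑ j ∈ Finset.range n, C (if j < k then -((j : ℝ) + 1) else (n : ℝ) - j) * X ^ j

theorem isCharRoot_iff {k n : ℕ} {r : ℝ} : IsCharRoot k n r ↔ (charPoly k n).eval r = 0 := by
  rw [IsCharRoot, charPoly]
  simp only [eval_sub, eval_finsetSum, eval_pow, eval_X, eval_mul, eval_C]
  constructor <;> intro h <;> linarith

theorem coeff_geom_sum (n i : ℕ) :
    (∑ j ∈ Finset.range n, X ^ j : ℝ[X]).coeff i = if i < n then 1 else 0 := by
  simp [coeff_X_pow]

theorem coeff_diffPoly (k n i : ℕ) : (diffPoly k n).coeff i =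
    if i < n then (if i < k then -((i : ℝ) + 1) else (n : ℝ) - i) else 0 := by
  simp [diffPoly, coeff_X_pow]

theorem X_sub_one_mul_diffPoly {k n : ℕ} (hkn : k < n) :
    (X - C 1) * diffPoly k n = charPoly k n := by
  ext i
  rcases i with _ | i
  · rw [charPoly, coeff_sub, coeff_geom_sum, mul_coeff_zero, coeff_diffPoly, coeff_C_mul,
      coeff_X_pow]
    rcases Nat.eq_zero_or_pos k with rfl | hk
    · simp [hkn]
    · simp [hk, hk.ne, show 0 < n by omega]
  · rw [charPoly, coeff_sub, coeff_geom_sum, coeff_X_sub_C_mul, coeff_diffPoly, coeff_diffPoly,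
      coeff_C_mul, coeff_X_pow]
    rcases lt_trichotomy (i + 1) k with h | h | h
    · simp [show i < n by omega, show i < k by omega, h, h.ne, show i + 1 < n by omega]
    · subst h
      simp [show i < n by omega, hkn]
      ring
    · rcases lt_trichotomy (i + 1) n with h' | h' | h'
      · simp [show i < n by omega, show ¬ i < k by omega, h.ne', h', show ¬ i + 1 < k by omega]
      · subst h'
        simp [show ¬ i < k by omega, h.ne']
      · simp [show ¬ i < n by omega, h.ne', show ¬ i + 1 < n by omega]

/-- The value at 1 of p/(X - 1) is p'(1). It decides whether 1 is a double root of p, which happens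
only for n = 2k. -/
theorem two_mul_eval_one_diffPoly {k n : ℕ} (hkn : k < n) :
    2 * (diffPoly k n).eval 1 = ((n : ℝ) + 1) * ((n : ℝ) - 2 * k) := by
  have h1 : (derivative (charPoly k n)).eval 1 = (diffPoly k n).eval 1 := by
    rw [← X_sub_one_mul_diffPoly hkn]
    simp
  have h2 : (∑ i ∈ Finset.range (n + 1), (i : ℝ)) * 2 = (n + 1) * n := by
    have := Finset.sum_range_id_mul_two (n + 1)
    rw [Nat.add_sub_cancel] at this
    have h3 := congrArg (Nat.cast (R := ℝ)) this
    push_cast at h3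
    exact h3
  rw [← h1, charPoly]
  simp only [derivative_sub, derivative_sum, derivative_X_pow, derivative_C_mul, eval_sub,
    eval_finsetSum, eval_mul, eval_C, eval_pow, eval_X, one_pow, mul_one]
  linarith

/-- The positive root of `diffPoly k n`. -/
theorem exists_posRoot {k n : ℕ} (hk : 0 < k) (hkn : k < n) :
    ∃ (R : ℝ) (H : ℝ[X]), 0 < R ∧ diffPoly k n = (X - C R) * H ∧ (∀ j, 0 ≤ H.coeff j) ∧
      H ≠ 0 ∧ ∀ x, 0 < x → ((diffPoly k n).eval x = 0 ↔ x = R) := by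
  refine exists_factor_of_sign_change (s := k) (d := k) ?_ ?_ ?_ ?_
  · intro i hi
    rw [coeff_diffPoly, if_pos (by omega), if_pos hi]
    have : (0 : ℝ) ≤ i := i.cast_nonneg
    linarith
  · intro i hi
    rw [coeff_diffPoly]
    split_ifs with h1 h2
    · omega
    · have : (i : ℝ) ≤ n := by exact_mod_cast h1.le
      linarith
    · exact le_rfl
  · rw [coeff_diffPoly, if_pos (by omega), if_pos hk]
    norm_num
  · rw [coeff_diffPoly, if_pos hkn, if_neg (lt_irrefl k)]
    have : (k : ℝ) < n := by exact_mod_cast hkn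
    linarith

theorem isThePosRoot_of_ne {k n : ℕ} (hkn : k < n) {R : ℝ} (hR : 0 < R) (hne : n ≠ 2 * k)
    (huniq : ∀ x, 0 < x → ((diffPoly k n).eval x = 0 ↔ x = R)) :
    IsThePosRoot k n R ∧ R ≠ 1 := by
  have hR1 : R ≠ 1 := by
    rintro rfl
    have h1 := two_mul_eval_one_diffPoly hkn
    rw [(huniq 1 hR).2 rfl, mul_zero, eq_comm, mul_eq_zero] at h1
    rcases h1 with h1 | h1
    · have : (0 : ℝ) ≤ n := n.cast_nonneg
      linarith
    · apply hne
      have : (n : ℝ) = 2 * k := by linarith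
      exact_mod_cast this
  refine ⟨fun s => ?_, hR1⟩
  rw [isCharRoot_iff, ← X_sub_one_mul_diffPoly hkn]
  simp only [eval_mul, eval_sub, eval_X, eval_C, mul_eq_zero, sub_eq_zero]
  constructor
  · rintro ⟨h1, h2, h3⟩
    exact (huniq s h1).1 (h3.resolve_left h2)
  · rintro rfl
    exact ⟨hR, hR1, Or.inr ((huniq s hR).2 rfl)⟩

theorem posRoot_eq_one {k n : ℕ} (hkn : k < n) {R : ℝ} (hne : n = 2 * k)
    (huniq : ∀ x, 0 < x → ((diffPoly k n).eval x = 0 ↔ x = R)) : R = 1 := by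
  have h1 := two_mul_eval_one_diffPoly hkn
  refine ((huniq 1 one_pos).1 ?_).symm
  have : (n : ℝ) = 2 * k := by exact_mod_cast hne
  rw [this, sub_self, mul_zero] at h1
  linarith

theorem aeval_shift_geom_sum (n : ℕ) (t : ℤ → ℝ) (m : ℤ) :
    aeval shift (∑ i ∈ Finset.range n, X ^ i : ℝ[X]) t m = ∑ i ∈ Finset.range n, t (m + i) := by
  simp [shift_pow_apply]

theorem aeval_shift_charPoly (k n : ℕ) (t : ℤ → ℝ) (m : ℤ) :
    aeval shift (charPoly k n) t m =
      ∑ i ∈ Finset.range (n + 1), t (m + i) - ((n : ℝ) + 1) * t (m + k) := by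
  rw [charPoly, map_sub, LinearMap.sub_apply, Pi.sub_apply, aeval_shift_geom_sum,
    map_mul, aeval_C, aeval_X_pow, Module.End.mul_apply, Module.algebraMap_end_apply,
    Pi.smul_apply, shift_pow_apply, smul_eq_mul]

/-- The differences of a strictly monotone two-sided solution of the recurrence are geometric. -/
theorem diff_geometric_of_pos {k n : ℕ} (hkn : k < n) {R : ℝ} {H : ℝ[X]}
    (hR : 0 < R) (hfac : diffPoly k n = (X - C R) * H) (hH : ∀ j, 0 ≤ H.coeff j) (hH0 : H ≠ 0)
    {x : ℤ → ℝ} (hx : aeval shift (charPoly k n) x = 0) (hmono : ∀ m, x m < x (m + 1)) (m : ℤ) :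
    x (m + 1 + 1) - x (m + 1) = R * (x (m + 1) - x m) := by
  set d : ℤ → ℝ := aeval shift (X - C 1 : ℝ[X]) x with hd
  have hdm : ∀ m, d m = x (m + 1) - x m := fun m => by simp [hd, shift_apply]
  have hdq : aeval shift ((X - C R) * H) d = 0 := by
    rw [← hfac, hd, ← Module.End.mul_apply, ← map_mul, mul_comm, X_sub_one_mul_diffPoly hkn, hx]
  have hdp : aeval shift (charPoly k n) d = 0 := by
    rw [← X_sub_one_mul_diffPoly hkn, hfac, map_mul, Module.End.mul_apply, hdq, map_zero]
  -- The averaging relation is the mean equation itself, which the differences inherit; k < n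
  -- ensures that the consecutive places k and k + 1 are both charged.
  have key := succ_eq_mul_of_pos (t := d) (fun m => by rw [hdm]; linarith [hmono m]) hR hH hH0 hdq
    (A := ∑ i ∈ Finset.range (n + 1), X ^ i)
    (fun i => by rw [coeff_geom_sum]; split_ifs <;> norm_num)
    (α := (n : ℝ) + 1) (j := k) (c := k)
    (by rw [coeff_geom_sum, if_pos (by omega)]; exact one_pos)
    (by rw [coeff_geom_sum, if_pos (by omega)]; exact one_pos)
    (by
      have h1 : (charPoly k n).eval R = 0 := by
        rw [← X_sub_one_mul_diffPoly hkn, hfac]; simp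
      rw [charPoly, eval_sub, sub_eq_zero] at h1
      rw [h1]; simp)
    (fun m => by
      have h1 := congrFun hdp m
      rw [aeval_shift_charPoly, Pi.zero_apply, sub_eq_zero] at h1
      rw [aeval_shift_geom_sum, h1]) m
  rwa [hdm, hdm] at key

/-! ### The negative root -/

/-- The alternating case: `(X - 1) * charPoly` at `-r`, up to sign, when `n` is odd. -/
noncomputable def altPoly (k n : ℕ) : ℝ[X] :=
  X ^ (n + 1) + C ((-1) ^ k * ((n : ℝ) + 1)) * (X ^ (k + 1) + X ^ k) - 1

theorem eval_altPoly {k n : ℕ} (hn : Odd n) (r : ℝ) :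
    (altPoly k n).eval r = (-r - 1) * (charPoly k n).eval (-r) := by
  have h1 := mul_geom_sum (-r) (n + 1)
  simp only [altPoly, charPoly, eval_sub, eval_add, eval_finsetSum, eval_pow, eval_X, eval_mul,
    eval_C, eval_one]
  rw [mul_sub, h1, hn.add_one.neg_pow, neg_pow r k]
  ring

theorem coeff_altPoly (k n i : ℕ) : (altPoly k n).coeff i =
    (if i = n + 1 then 1 else 0) + (-1) ^ k * ((n : ℝ) + 1) *
      ((if i = k + 1 then 1 else 0) + if i = k then 1 else 0) - if i = 0 then 1 else 0 := by
  simp only [altPoly, coeff_sub, coeff_add, coeff_C_mul, coeff_X_pow, coeff_one]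

/-- Multiplying by X - 1 makes the polynomial sparse, so that after X ↦ -X only one sign change
remains: right after the constant term for k even, just before the leading term for k odd. The extra
factor -r - 1 has no zero at positive r. -/
theorem exists_negRoot {k n : ℕ} (hk : 0 < k) (hkn : k < n) (hn : Odd n) :
    ∃ (R : ℝ) (H : ℝ[X]), 0 < R ∧ altPoly k n = (X - C R) * H ∧ (∀ j, 0 ≤ H.coeff j) ∧
      H ≠ 0 ∧ IsTheNegRoot k n (-R) := by
  have hn0 : (0 : ℝ) ≤ n := n.cast_nonneg
  have h0 : (altPoly k n).coeff 0 < 0 := by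
    rw [coeff_altPoly, if_neg (by omega), if_neg (by omega), if_neg (by omega), if_pos rfl]
    norm_num
  have hd : 0 < (altPoly k n).coeff (n + 1) := by
    rw [coeff_altPoly, if_pos rfl, if_neg (by omega), if_neg (by omega), if_neg (by omega)]
    norm_num
  have key : ∃ s, (∀ i < s, (altPoly k n).coeff i ≤ 0) ∧
      ∀ i, s ≤ i → 0 ≤ (altPoly k n).coeff i := by
    rcases Nat.even_or_odd k with hke | hko
    · refine ⟨1, fun i hi => ?_, fun i hi => ?_⟩
      · obtain rfl : i = 0 := by omega
        exact h0.le
      · rw [coeff_altPoly, hke.neg_one_pow, if_neg (show i ≠ 0 by omega)]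
        split_ifs <;> first | omega | linarith
    · refine ⟨n + 1, fun i hi => ?_, fun i hi => ?_⟩
      · rw [coeff_altPoly, hko.neg_one_pow, if_neg (show i ≠ n + 1 by omega)]
        split_ifs <;> first | omega | linarith
      · rw [coeff_altPoly, hko.neg_one_pow, if_neg (show i ≠ k + 1 by omega),
          if_neg (show i ≠ k by omega), if_neg (show i ≠ 0 by omega)]
        split_ifs <;> norm_num
  obtain ⟨s, hneg, hpos⟩ := key
  obtain ⟨R, H, hR, hfac, hH, hH0, huniq⟩ := exists_factor_of_sign_change hneg hpos h0 hd
  refine ⟨R, H, hR, hfac, hH, hH0, fun r => ?_⟩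
  rw [isCharRoot_iff]
  constructor
  · rintro ⟨hr, h⟩
    have := (huniq (-r) (by linarith)).1 (by rw [eval_altPoly hn, neg_neg, h, mul_zero])
    linarith
  · rintro rfl
    refine ⟨by linarith, ?_⟩
    have := (huniq R hR).2 rfl
    rw [eval_altPoly hn] at this
    exact (mul_eq_zero.1 this).resolve_left (by linarith)

theorem aeval_shift_altPoly (k n : ℕ) (t : ℤ → ℝ) (m : ℤ) :
    aeval shift (altPoly k n) t m = t (m + (n + 1 : ℕ)) +
      (-1) ^ k * ((n : ℝ) + 1) * (t (m + (k + 1 : ℕ)) + t (m + k)) - t m := by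
  simp only [altPoly, map_sub, map_add, map_mul, aeval_X_pow, aeval_C, map_one,
    LinearMap.sub_apply, LinearMap.add_apply, Module.End.mul_apply, Pi.sub_apply, Pi.add_apply,
    shift_pow_apply, Module.algebraMap_end_apply, Pi.smul_apply, smul_eq_mul, Module.End.one_apply]
  ring

/-- A positive two-sided sequence annihilated by `altPoly` is geometric. -/
theorem succ_eq_mul_of_altPoly {k n : ℕ} (hk : 0 < k) (hkn : k < n) {R : ℝ}
    {H : ℝ[X]} (hR : 0 < R) (hfac : altPoly k n = (X - C R) * H) (hH : ∀ j, 0 ≤ H.coeff j)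
    (hH0 : H ≠ 0) {t : ℤ → ℝ} (ht : ∀ m, 0 < t m) (hann : aeval shift (altPoly k n) t = 0)
    (m : ℤ) : t (m + 1) = R * t m := by
  have hn0 : (0 : ℝ) ≤ n := n.cast_nonneg
  have hrec := fun m => congrFun hann m
  simp only [aeval_shift_altPoly, Pi.zero_apply] at hrec
  have hev : (altPoly k n).eval R = 0 := by rw [hfac]; simp
  simp only [altPoly, eval_sub, eval_add, eval_pow, eval_X, eval_mul, eval_C, eval_one] at hev
  -- The recurrence expresses one extreme term as a positive combination of the others: t_m for k
  -- even (c = 0), t_{m+n+1} for k odd (c = n + 1).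
  rcases Nat.even_or_odd k with hke | hko
  · rw [hke.neg_one_pow] at hev
    simp only [hke.neg_one_pow] at hrec
    refine succ_eq_mul_of_pos ht hR hH hH0 (hfac ▸ hann)
      (A := X ^ (n + 1) + C ((n : ℝ) + 1) * (X ^ (k + 1) + X ^ k)) (fun i => ?_)
      (α := 1) (j := k) (c := 0) ?_ ?_ ?_ (fun m => ?_) m
    · simp only [coeff_add, coeff_C_mul, coeff_X_pow]
      split_ifs <;> first | omega | linarith
    · simp only [coeff_add, coeff_C_mul, coeff_X_pow]
      split_ifs <;> first | omega | linarith
    · simp only [coeff_add, coeff_C_mul, coeff_X_pow]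
      split_ifs <;> first | omega | linarith
    · simp; linarith
    · have := hrec m
      simp only [map_add, map_mul, aeval_X_pow, aeval_C, LinearMap.add_apply,
        Module.End.mul_apply, Pi.add_apply, shift_pow_apply, Module.algebraMap_end_apply,
        Pi.smul_apply, smul_eq_mul, Nat.cast_zero, add_zero]
      linarith
  · rw [hko.neg_one_pow] at hev
    simp only [hko.neg_one_pow] at hrec
    refine succ_eq_mul_of_pos ht hR hH hH0 (hfac ▸ hann)
      (A := C ((n : ℝ) + 1) * (X ^ (k + 1) + X ^ k) + 1) (fun i => ?_)
      (α := 1) (j := k) (c := n + 1) ?_ ?_ ?_ (fun m => ?_) m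
    · simp only [coeff_add, coeff_C_mul, coeff_X_pow, coeff_one]
      split_ifs <;> first | omega | linarith
    · simp only [coeff_add, coeff_C_mul, coeff_X_pow, coeff_one]
      split_ifs <;> first | omega | linarith
    · simp only [coeff_add, coeff_C_mul, coeff_X_pow, coeff_one]
      split_ifs <;> first | omega | linarith
    · simp; linarith
    · have := hrec m
      simp only [map_add, map_mul, aeval_X_pow, aeval_C, map_one, LinearMap.add_apply,
        Module.End.mul_apply, Pi.add_apply, shift_pow_apply, Module.algebraMap_end_apply,
        Pi.smul_apply, smul_eq_mul, Module.End.one_apply]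
      linarith

end

section

open Polynomial Filter Topology

/-! ### From displacements to the shape of the map -/

theorem exists_zpow_gt {r : ℝ} (hr : 0 < r) (hr1 : r ≠ 1) (K : ℝ) : ∃ m : ℤ, K < r ^ m := by
  rcases lt_or_gt_of_ne hr1 with h | h
  · obtain ⟨j, hj⟩ := pow_unbounded_of_one_lt K ((one_lt_inv₀ hr).2 h)
    exact ⟨-j, by simpa using hj⟩
  · obtain ⟨j, hj⟩ := pow_unbounded_of_one_lt K h
    exact ⟨j, by simpa using hj⟩

theorem exists_zpow_mul_lt {r : ℝ} (hr : 0 < r) (hr1 : r ≠ 1) (K : ℝ) {ε : ℝ} (hε : 0 < ε) :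
    ∃ m : ℤ, K * r ^ m < ε := by
  obtain ⟨m, hm⟩ := exists_zpow_gt hr hr1 (K / ε)
  refine ⟨-m, ?_⟩
  have : 0 < r ^ m := zpow_pos hr m
  rw [zpow_neg, ← div_eq_mul_inv, div_lt_iff₀ this]
  rwa [div_lt_iff₀ hε, mul_comm] at hm

/-- The hyperbolic case: an increasing bijection whose displacement is multiplied by `r ≠ 1` along
orbits has three affine pieces. -/
theorem isThreePiece_of_displacement {I : Set ℝ} (hI : I.Nonempty) (o : I ≃o I) {r : ℝ}
    (hr : 0 < r) (hr1 : r ≠ 1) (ho : ∀ x : I, (o (o x) : ℝ) - o x = r * ((o x : ℝ) - x)) :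
    IsThreePiece o r := by
  have hr1' : r - 1 ≠ 0 := sub_ne_zero.2 hr1
  -- These give the orbit in the form A + r^m B, with A constant along orbits and B multiplied by r.
  -- The sign of B tells on which side of A the point lies.
  obtain ⟨B, hB⟩ : ∃ B : I → ℝ, ∀ x, B x = ((o x : ℝ) - x) / (r - 1) := ⟨_, fun _ => rfl⟩
  obtain ⟨A, hA⟩ : ∃ A : I → ℝ, ∀ x, A x = (x : ℝ) - B x := ⟨_, fun _ => rfl⟩
  have hfx : ∀ x : I, (o x : ℝ) = r * (x - A x) + A x := by
    intro x
    have : (r - 1) * B x = (o x : ℝ) - x := by rw [hB]; field_simp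
    rw [hA]; linarith
  have hBo : ∀ x, B (o x) = r * B x := fun x => by rw [hB, ho, hB, mul_div_assoc]
  have hAo : ∀ x, A (o x) = 1 * A x := fun x => by
    rw [hA, hBo, one_mul, hfx, hA]; ring
  have hzs : ∀ (m : ℤ) (x : I), (o ^ (m + 1)) x = o ((o ^ m) x) := fun m x => by
    rw [add_comm, zpow_add, zpow_one]; rfl
  have hBm : ∀ (m : ℤ) x, B ((o ^ m) x) = r ^ m * B x := fun m x =>
    eq_zpow_mul_of_succ_eq_mul (t := fun m => B ((o ^ m) x)) hr.ne' (fun m => by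
      rw [hzs, hBo]) m
  have hAm : ∀ (m : ℤ) x, A ((o ^ m) x) = A x := fun m x => by
    have := eq_zpow_mul_of_succ_eq_mul (t := fun m => A ((o ^ m) x)) one_ne_zero (fun m => by
      rw [hzs, hAo]) m
    simpa using this
  have horb : ∀ (m : ℤ) x, ((o ^ m) x : ℝ) = A x + r ^ m * B x := fun m x => by
    rw [← hAm m, ← hBm, hA]; ring
  have hlt : ∀ (m : ℤ) {x y : I}, x < y → A x + r ^ m * B x < A y + r ^ m * B y := by
    intro m x y hxy
    rw [← horb, ← horb]
    exact (o ^ m).strictMono hxy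
  -- Orbits never cross: letting r^m → ∞ compares the values of B, and letting r^m → 0 compares
  -- those of A.
  have hBmono : Monotone B := by
    refine monotone_iff_forall_lt.2 fun x y hxy => ?_
    by_contra! h
    obtain ⟨m, hm⟩ := exists_zpow_gt hr hr1 ((A y - A x) / (B x - B y))
    rw [div_lt_iff₀ (by linarith)] at hm
    linarith [hlt m hxy]
  have hAmono : Monotone A := by
    refine monotone_iff_forall_lt.2 fun x y hxy => ?_
    by_contra! h
    obtain ⟨m, hm⟩ := exists_zpow_mul_lt hr hr1 (B y - B x) (sub_pos.2 h)
    linarith [hlt m hxy]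
  -- The orbit of y passes above x while keeping its value of A. By symmetry all points with B > 0
  -- share one value of A, which becomes the break point b.
  have hAU : ∀ x y, 0 < B x → 0 < B y → A x ≤ A y := by
    intro x y _ hy
    obtain ⟨m, hm⟩ := exists_zpow_gt hr hr1 ((x - A y) / B y)
    rw [div_lt_iff₀ hy] at hm
    rw [← hAm m y]
    refine hAmono (Subtype.coe_le_coe.1 ?_)
    rw [horb]; linarith
  have hAL : ∀ x y, B x < 0 → B y < 0 → A x ≤ A y := by
    intro x y hx _
    obtain ⟨m, hm⟩ := exists_zpow_gt hr hr1 ((A x - y) / (-B x))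
    rw [div_lt_iff₀ (by linarith)] at hm
    rw [← hAm m x]
    refine hAmono (Subtype.coe_le_coe.1 ?_)
    rw [horb]; linarith
  have hcl : ∀ x : I, ((A x : ℝ) : EReal) ∈ closure ((fun x : ℝ => (x : EReal)) '' I) := by
    intro x
    refine image_closure_subset_closure_image continuous_coe_real_ereal ⟨A x, ?_, rfl⟩
    refine Metric.mem_closure_iff.2 fun ε hε => ?_
    obtain ⟨m, hm⟩ := exists_zpow_mul_lt hr hr1 |B x| hε
    refine ⟨_, ((o ^ m) x).2, ?_⟩
    rw [horb, Real.dist_eq, sub_add_cancel_left, abs_neg, abs_mul, abs_of_pos (zpow_pos hr m),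
      mul_comm]
    exact hm
  have hUpper : ∃ b : EReal, b ∈ closure ((fun x : ℝ => (x : EReal)) '' I) ∧
      (∀ x : I, 0 < B x → b = (A x : ℝ)) ∧ (∀ x : I, b < ((x : ℝ) : EReal) → 0 < B x) ∧
      ((∃ y, 0 < B y ∧ b = (A y : ℝ)) ∨ b = sSup ((fun x : ℝ => (x : EReal)) '' I)) := by
    by_cases hU : ∃ y, 0 < B y
    · obtain ⟨y, hy⟩ := hU
      refine ⟨(A y : ℝ), hcl y, fun x hx => ?_, fun x hx => ?_, Or.inl ⟨y, hy, rfl⟩⟩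
      · rw [le_antisymm (hAU x y hx hy) (hAU y x hy hx)]
      · rw [EReal.coe_lt_coe_iff] at hx
        obtain ⟨m, hm⟩ := exists_zpow_mul_lt hr hr1 (B y) (sub_pos.2 hx)
        have h1 : (o ^ m) y ≤ x := Subtype.coe_le_coe.1 (by rw [horb]; linarith)
        have h2 := hBmono h1
        rw [hBm] at h2
        exact (mul_pos (zpow_pos hr m) hy).trans_le h2
    -- With no point of positive B, the supremum of I in the extended line serves as b, and nothing
    -- lies beyond it.
    · refine ⟨_, sSup_mem_closure (hI.image _), fun x hx => absurd ⟨x, hx⟩ hU, fun x hx => ?_,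
        Or.inr rfl⟩
      exact absurd (le_sSup (Set.mem_image_of_mem _ x.2)) (not_le.2 hx)
  have hLower : ∃ a : EReal, a ∈ closure ((fun x : ℝ => (x : EReal)) '' I) ∧
      (∀ x : I, B x < 0 → a = (A x : ℝ)) ∧ (∀ x : I, ((x : ℝ) : EReal) < a → B x < 0) ∧
      ((∃ y, B y < 0 ∧ a = (A y : ℝ)) ∨ a = sInf ((fun x : ℝ => (x : EReal)) '' I)) := by
    by_cases hL : ∃ y, B y < 0
    · obtain ⟨y, hy⟩ := hL
      refine ⟨(A y : ℝ), hcl y, fun x hx => ?_, fun x hx => ?_, Or.inl ⟨y, hy, rfl⟩⟩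
      · rw [le_antisymm (hAL x y hx hy) (hAL y x hy hx)]
      · rw [EReal.coe_lt_coe_iff] at hx
        obtain ⟨m, hm⟩ := exists_zpow_mul_lt hr hr1 (-B y) (sub_pos.2 hx)
        have h1 : x ≤ (o ^ m) y := Subtype.coe_le_coe.1 (by rw [horb]; linarith)
        have h2 := hBmono h1
        rw [hBm] at h2
        exact h2.trans_lt (mul_neg_of_pos_of_neg (zpow_pos hr m) hy)
    · refine ⟨_, sInf_mem_closure (hI.image _), fun x hx => absurd ⟨x, hx⟩ hL, fun x hx => ?_,
        Or.inr rfl⟩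
      exact absurd (sInf_le (Set.mem_image_of_mem _ x.2)) (not_le.2 hx)
  obtain ⟨a, hacl, haL, haB, ha⟩ := hLower
  obtain ⟨b, hbcl, hbU, hbB, hb⟩ := hUpper
  have hleSup : ∀ z ∈ closure ((fun x : ℝ => (x : EReal)) '' I),
      z ≤ sSup ((fun x : ℝ => (x : EReal)) '' I) := fun z hz =>
    closure_minimal (fun _ h => le_sSup h) isClosed_Iic hz
  have hInfle : ∀ z ∈ closure ((fun x : ℝ => (x : EReal)) '' I),
      sInf ((fun x : ℝ => (x : EReal)) '' I) ≤ z := fun z hz =>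
    closure_minimal (fun _ h => sInf_le h) isClosed_Ici hz
  obtain ⟨x₀, hx₀⟩ := hI
  have hab : a ≤ b := by
    rcases ha with ⟨y, hy, rfl⟩ | rfl
    · rcases hb with ⟨z, hz, rfl⟩ | rfl
      · refine EReal.coe_le_coe_iff.2 (hAmono (le_of_not_ge fun h => ?_))
        linarith [hBmono h]
      · exact hleSup _ hacl
    · exact hInfle _ hbcl
  have hatop : a ≠ ⊤ := by
    rcases ha with ⟨y, hy, rfl⟩ | rfl
    · exact EReal.coe_ne_top _
    · exact ((sInf_le (Set.mem_image_of_mem _ hx₀)).trans_lt (EReal.coe_lt_top x₀)).ne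
  have hbbot : b ≠ ⊥ := by
    rcases hb with ⟨y, hy, rfl⟩ | rfl
    · exact EReal.coe_ne_bot _
    · exact ((EReal.bot_lt_coe x₀).trans_le (le_sSup (Set.mem_image_of_mem _ hx₀))).ne'
  have hbx : ∀ x : I, 0 < B x → b < ((x : ℝ) : EReal) := fun x hx => by
    rw [hbU x hx, EReal.coe_lt_coe_iff, hA]; linarith
  have hxa : ∀ x : I, B x < 0 → ((x : ℝ) : EReal) < a := fun x hx => by
    rw [haL x hx, EReal.coe_lt_coe_iff, hA]; linarith
  have hmid : ∀ x : I, a ≤ ((x : ℝ) : EReal) → ((x : ℝ) : EReal) ≤ b → (o x : ℝ) = x := by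
    intro x h1 h2
    have hB0 : B x = 0 := le_antisymm (not_lt.1 fun h => (hbx x h).not_ge h2)
      (not_lt.1 fun h => (hxa x h).not_ge h1)
    rw [hfx, hA, hB0]; ring
  refine ⟨a, b, hacl, hbcl, hab, hatop, hbbot, fun x => ⟨fun h => ?_, fun h1 h2 =>
    hmid x h1.le h2.le, fun h => ?_⟩⟩
  · rcases h.lt_or_eq with h | h
    · rw [haL x (haB x h), EReal.toReal_coe]
      exact hfx x
    · rw [hmid x h.ge (h.le.trans hab), ← h, EReal.toReal_coe]; ring
  · rcases h.lt_or_eq with h | h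
    · rw [hbU x (hbB x h), EReal.toReal_coe]
      exact hfx x
    · rw [hmid x (hab.trans h.le) h.ge, h, EReal.toReal_coe]; ring

/-- The parabolic case: an increasing bijection whose displacement is constant along orbits is a
translation. -/
theorem exists_translation_of_displacement {I : Set ℝ} (hI : I.Nonempty) (o : I ≃o I)
    (ho : ∀ x : I, (o (o x) : ℝ) - o x = (o x : ℝ) - x) : ∃ c : ℝ, ∀ x : I, (o x : ℝ) = x + c := by
  have hzs : ∀ (m : ℤ) (x : I), (o ^ (m + 1)) x = o ((o ^ m) x) := fun m x => by
    rw [add_comm, zpow_add, zpow_one]; rfl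
  have hdisp : ∀ (m : ℤ) (x : I), (o ((o ^ m) x) : ℝ) - (o ^ m) x = (o x : ℝ) - x := by
    intro m x
    have := eq_zpow_mul_of_succ_eq_mul (t := fun m => (o ((o ^ m) x) : ℝ) - (o ^ m) x)
      one_ne_zero (fun m => by rw [hzs, ho, one_mul]) m
    simpa using this
  have horb : ∀ (m : ℤ) (x : I), ((o ^ m) x : ℝ) = x + m * ((o x : ℝ) - x) := by
    intro m x
    have := eq_zpow_mul_of_succ_eq_mul (t := fun m => ((o ^ m) x : ℝ) - m * ((o x : ℝ) - x))
      one_ne_zero (fun m => by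
        have := hdisp m x
        rw [hzs]; push_cast; linarith) m
    simp only [one_zpow, one_mul, zpow_zero, Int.cast_zero, zero_mul, sub_zero] at this
    have h0 : (((1 : I ≃o I) x : I) : ℝ) = x := rfl
    rw [h0] at this
    linarith
  have hle : ∀ x y : I, x < y → (o x : ℝ) - x = (o y : ℝ) - y := by
    intro x y hxy
    -- Orbits are arithmetic progressions; unequal steps would make two of them cross at some
    -- positive or negative time.
    have key : ∀ m : ℤ, (x : ℝ) + m * ((o x : ℝ) - x) < y + m * ((o y : ℝ) - y) := fun m => by
      rw [← horb, ← horb]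
      exact (o ^ m).strictMono hxy
    by_contra hne
    set δ := ((o x : ℝ) - x) - ((o y : ℝ) - y) with hδ
    have hδ0 : δ ≠ 0 := sub_ne_zero.2 hne
    rcases lt_or_gt_of_ne hδ0 with h | h
    · obtain ⟨j, hj⟩ := exists_nat_gt ((y - x : ℝ) / (-δ))
      rw [div_lt_iff₀ (by linarith)] at hj
      have := key (-j)
      push_cast at this
      nlinarith
    · obtain ⟨j, hj⟩ := exists_nat_gt ((y - x : ℝ) / δ)
      rw [div_lt_iff₀ h] at hj
      have := key j
      push_cast at this
      nlinarith
  obtain ⟨x₀, hx₀⟩ := hI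
  refine ⟨(o ⟨x₀, hx₀⟩ : ℝ) - x₀, fun x => ?_⟩
  rcases lt_trichotomy x ⟨x₀, hx₀⟩ with h | h | h
  · linarith [hle _ _ h]
  · subst h; ring
  · linarith [hle _ _ h]

end

section

open Polynomial

/-! ### Orbits of solutions of the mean equation -/

/-- `f^k` is the arithmetic mean of `f^0, …, f^n`. -/
def IsMeanIterate {I : Set ℝ} (k n : ℕ) (f : I → I) : Prop :=
  ∀ x : I, (f^[k] x : ℝ) = 1 / ((n : ℝ) + 1) * ∑ i ∈ Finset.range (n + 1), (f^[i] x : ℝ)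

namespace IsMeanIterate

variable {I : Set ℝ} {k n : ℕ} {f : I → I}

theorem sum_eq (h : IsMeanIterate k n f) (x : I) :
    ∑ i ∈ Finset.range (n + 1), (f^[i] x : ℝ) = ((n : ℝ) + 1) * f^[k] x := by
  have hn : (n : ℝ) + 1 ≠ 0 := by positivity
  rw [h x]
  field_simp

/-- If f x = f y, all iterates of positive order agree, including the k-th; the mean equation then
leaves only the zeroth terms, which must be equal. -/
theorem injective (hk : 0 < k) (h : IsMeanIterate k n f) : Function.Injective f := by
  intro x y hxy
  have hit : ∀ i, f^[i + 1] x = f^[i + 1] y := fun i => by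
    rw [Function.iterate_succ_apply, hxy, ← Function.iterate_succ_apply]
  have hx := h.sum_eq x
  have hy := h.sum_eq y
  obtain ⟨k, rfl⟩ := Nat.exists_eq_succ_of_ne_zero hk.ne'
  rw [Finset.sum_range_succ'] at hx hy
  simp only [hit, Nat.succ_eq_add_one, Function.iterate_zero, id_eq] at hx hy
  exact Subtype.ext (by linarith)

/-- Subtracting the equation at x from the one at f x telescopes the sum; this is the recurrence of
(X - 1)p. -/
theorem iterate_succ_sub (h : IsMeanIterate k n f) (x : I) :
    (f^[n + 1] x : ℝ) - x = ((n : ℝ) + 1) * ((f^[k + 1] x : ℝ) - f^[k] x) := by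
  have h1 := h.sum_eq (f x)
  have h2 := h.sum_eq x
  simp only [← Function.iterate_succ_apply] at h1
  rw [Finset.sum_range_succ] at h1
  rw [Finset.sum_range_succ'] at h2
  simp only [Function.iterate_zero, id_eq, Nat.succ_eq_add_one] at h1 h2
  linarith

theorem aeval_shift_orbit (h : IsMeanIterate k n f) {x : ℤ → I}
    (hx : ∀ (m : ℤ) (i : ℕ), x (m + i) = f^[i] (x m)) :
    aeval shift (charPoly k n) (fun m => (x m : ℝ)) = 0 := by
  funext m
  rw [aeval_shift_charPoly, Pi.zero_apply, sub_eq_zero]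
  simp only [hx]
  exact h.sum_eq (x m)

end IsMeanIterate

theorem orbit_add_natCast {I : Type*} {f : I → I} {x : ℤ → I} (hx : ∀ m, x (m + 1) = f (x m))
    (m : ℤ) (i : ℕ) : x (m + i) = f^[i] (x m) := by
  induction i with
  | zero => simp
  | succ i ih => rw [Function.iterate_succ_apply', ← ih, ← hx]; push_cast; rw [add_assoc]

/-- An increasing solution multiplies displacements by the positive root of `diffPoly`. -/
theorem displacement_of_orderIso {I : Set ℝ} {k n : ℕ} (hkn : k < n) {R : ℝ} {H : ℝ[X]}
    (hR : 0 < R) (hfac : diffPoly k n = (X - C R) * H) (hH : ∀ j, 0 ≤ H.coeff j) (hH0 : H ≠ 0)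
    (o : I ≃o I) (h : IsMeanIterate k n o) (x : I) :
    (o (o x) : ℝ) - o x = R * ((o x : ℝ) - x) := by
  have hzs : ∀ (m : ℤ), (o ^ (m + 1)) x = o ((o ^ m) x) := fun m => by
    rw [add_comm, zpow_add, zpow_one]; rfl
  have hzs' : ∀ (m : ℤ), (o ^ (m + 1)) x = (o ^ m) (o x) := fun m => by
    rw [zpow_add, zpow_one]; rfl
  have hann := h.aeval_shift_orbit (x := fun m => (o ^ m) x)
    (orbit_add_natCast (x := fun m => (o ^ m) x) hzs)
  have h1 : ((o ^ (0 + 1 + 1 : ℤ)) x) = o (o x) := rfl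
  have h2 : ((o ^ (0 + 1 : ℤ)) x) = o x := rfl
  have h3 : ((o ^ (0 : ℤ)) x) = x := rfl
  rcases lt_trichotomy x (o x) with hx | hx | hx
  · have := diff_geometric_of_pos hkn hR hfac hH hH0 hann
      (fun m => by rw [hzs' m]; exact (o ^ m).strictMono hx) 0
    rwa [h1, h2, h3] at this
  · rw [← hx, ← hx]; ring
  · have hann' : aeval shift (charPoly k n) (-fun m : ℤ => (((o ^ m) x : I) : ℝ)) = 0 := by
      rw [map_neg, hann, neg_zero]
    have := diff_geometric_of_pos hkn hR hfac hH hH0 hann'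
      (fun m => by
        simp only [Pi.neg_apply, neg_lt_neg_iff]
        rw [hzs' m]; exact (o ^ m).strictMono hx) 0
    simp only [Pi.neg_apply] at this
    rw [h1, h2, h3] at this
    linarith

/-- A continuous decreasing self-map of an interval has a fixed point. -/
theorem exists_fixedPoint_of_antitone {I : Set ℝ} (hI : I.OrdConnected) (hne : I.Nonempty)
    {f : I → I} (hf : Continuous f) (hanti : Antitone f) : ∃ ξ, f ξ = ξ := by
  have : PreconnectedSpace I := Subtype.preconnectedSpace hI.isPreconnected
  obtain ⟨x, hx⟩ := hne
  -- Monotonicity reverses the inequality at f x, so f - id changes sign between x and f x.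
  rcases le_total (f ⟨x, hx⟩) ⟨x, hx⟩ with h | h
  · exact intermediate_value_univ₂ hf continuous_id h (hanti h)
  · exact intermediate_value_univ₂ hf continuous_id (hanti h) h

/-- Orbits of a decreasing bijection alternate around a fixed point. -/
theorem alternating_orbit_pos {I : Set ℝ} {f : I → I} (hanti : StrictAnti f) {ξ : I}
    (hξ : f ξ = ξ) {x : ℤ → I} (hx : ∀ m, x (m + 1) = f (x m)) (h0 : x 0 ≠ ξ) (m : ℤ) :
    0 < ((x 0 : ℝ) - ξ) * (-1) ^ m * ((x m : ℝ) - ξ) := by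
  have hstep : ∀ m : ℤ, 0 < ((x 0 : ℝ) - ξ) * (-1) ^ (m + 1) * ((x (m + 1) : ℝ) - ξ) ↔
      0 < ((x 0 : ℝ) - ξ) * (-1) ^ m * ((x m : ℝ) - ξ) := by
    intro m
    have h1 : (x (m + 1) : ℝ) - ξ < 0 ↔ 0 < (x m : ℝ) - ξ := by
      rw [sub_neg, sub_pos, Subtype.coe_lt_coe, Subtype.coe_lt_coe, hx]
      nth_rewrite 1 [← hξ]
      exact hanti.lt_iff_gt
    have h2 : 0 < (x (m + 1) : ℝ) - ξ ↔ (x m : ℝ) - ξ < 0 := by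
      rw [sub_neg, sub_pos, Subtype.coe_lt_coe, Subtype.coe_lt_coe, hx]
      nth_rewrite 1 [← hξ]
      exact hanti.lt_iff_gt
    rw [zpow_add_one₀ (by norm_num), mul_neg_one, mul_neg, neg_mul, neg_pos, mul_pos_iff,
      mul_neg_iff, h1, h2]
  induction m using Int.induction_on with
  | zero =>
    rw [zpow_zero, mul_one]
    exact mul_self_pos.2 (sub_ne_zero.2 fun h => h0 (Subtype.ext h))
  | succ i ih => exact (hstep _).2 ih
  | pred i ih => rw [← hstep, sub_add_cancel]; exact ih

/-- Every point of a bijection lies on a two-sided orbit. -/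
theorem exists_orbit {I : Type*} {f : I → I} (hf : Function.Bijective f) (y : I) :
    ∃ x : ℤ → I, x 0 = y ∧ ∀ m, x (m + 1) = f (x m) := by
  refine ⟨fun m => (Equiv.ofBijective f hf ^ m) y, rfl, fun m => ?_⟩
  change (Equiv.ofBijective f hf ^ (m + 1)) y = Equiv.ofBijective f hf _
  rw [add_comm, zpow_add, zpow_one]
  rfl

/-- In f^{n+1}(x) - x = (n+1)(f^{k+1}(x) - f^k(x)) the parities place f^{n+1}(x) and f^k(x) across ξ
from x, and f^{k+1}(x) on the same side as x. The two sides then have opposite signs. -/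
theorem not_strictAnti_of_odd_of_even {I : Set ℝ} (hI : I.OrdConnected) (hI' : I.Nontrivial)
    {k n : ℕ} (hk : Odd k) (hn : Even n) {f : I → I} (hf : Continuous f)
    (hbij : Function.Bijective f) (h : IsMeanIterate k n f) : ¬ StrictAnti f := by
  intro hanti
  obtain ⟨ξ, hξ⟩ := exists_fixedPoint_of_antitone hI hI'.nonempty hf hanti.antitone
  obtain ⟨y, hy, hyξ⟩ := hI'.exists_ne (ξ : ℝ)
  obtain ⟨x, hx0, hx⟩ := exists_orbit hbij ⟨y, hy⟩
  have hpos := alternating_orbit_pos hanti hξ hx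
    (by rw [hx0]; intro h; exact hyξ (congrArg Subtype.val h))
  have hit : ∀ i : ℕ, x i = f^[i] (x 0) := fun i => by
    simpa using orbit_add_natCast hx 0 i
  have h1 := h.iterate_succ_sub (x 0)
  rw [← hit, ← hit, ← hit] at h1
  have hp0 := hpos 0
  have hpn := hpos (n + 1 : ℕ)
  have hpk := hpos k
  have hpk' := hpos (k + 1 : ℕ)
  rw [zpow_natCast, hn.add_one.neg_one_pow] at hpn
  rw [zpow_natCast, hk.neg_one_pow] at hpk
  rw [zpow_natCast, hk.add_one.neg_one_pow] at hpk'
  rw [zpow_zero] at hp0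
  have hn0 : (0 : ℝ) < (n : ℝ) + 1 := by positivity
  have h2 := mul_pos hn0 (add_pos hpk hpk')
  have h3 : ((n : ℝ) + 1) * (((x 0 : ℝ) - ξ) * -1 * ((x k : ℝ) - ξ) +
      ((x 0 : ℝ) - ξ) * 1 * ((x (k + 1 : ℕ) : ℝ) - ξ)) =
      ((x 0 : ℝ) - ξ) * ((x (n + 1 : ℕ) : ℝ) - x 0) := by
    rw [h1]; ring
  rw [h3] at h2
  linarith

theorem exists_affine_of_strictAnti {I : Set ℝ} (hI : I.OrdConnected) (hI' : I.Nonempty)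
    {k n : ℕ} (hk : 0 < k) (hkn : k < n) (hn : Odd n) {R : ℝ} {H : ℝ[X]} (hR : 0 < R)
    (hfac : altPoly k n = (X - C R) * H) (hH : ∀ j, 0 ≤ H.coeff j) (hH0 : H ≠ 0)
    {f : I → I} (hf : Continuous f) (hbij : Function.Bijective f) (h : IsMeanIterate k n f)
    (hanti : StrictAnti f) : ∃ c : ℝ, ∀ x : I, (f x : ℝ) = -R * x + c := by
  obtain ⟨ξ, hξ⟩ := exists_fixedPoint_of_antitone hI hI' hf hanti.antitone
  refine ⟨(1 + R) * ξ, fun y => ?_⟩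
  by_cases hyξ : y = ξ
  · rw [hyξ, hξ]; ring
  obtain ⟨x, hx0, hx⟩ := exists_orbit hbij y
  set t : ℤ → ℝ := fun m => ((x 0 : ℝ) - ξ) * (-1) ^ m * ((x m : ℝ) - ξ) with ht
  -- Since n + 1 is even, the outer terms keep their signs, while the factor (-1)^k turns the
  -- difference of the two middle terms into a sum.
  have hann : aeval shift (altPoly k n) t = 0 := by
    funext m
    have h1 := h.iterate_succ_sub (x m)
    simp only [← orbit_add_natCast hx] at h1
    have hk2 : ((-1 : ℝ) ^ k) * (-1) ^ k = 1 := by rw [← mul_pow]; simp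
    rw [aeval_shift_altPoly, Pi.zero_apply]
    simp only [ht, zpow_add₀ (show (-1 : ℝ) ≠ 0 by norm_num), zpow_natCast,
      hn.add_one.neg_one_pow, pow_succ (-1 : ℝ) k]
    linear_combination ((x 0 : ℝ) - ξ) * (-1) ^ m * h1 +
      ((x 0 : ℝ) - ξ) * (-1) ^ m * ((n : ℝ) + 1) *
        ((x (m + k) : ℝ) - x (m + (k + 1 : ℕ))) * hk2
  have h1 := succ_eq_mul_of_altPoly hk hkn hR hfac hH hH0
    (alternating_orbit_pos hanti hξ hx (by rwa [hx0])) hann 0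
  have hy0 : (y : ℝ) - ξ ≠ 0 := sub_ne_zero.2 fun h => hyξ (Subtype.ext h)
  simp only [hx0, zero_add, zpow_one, zpow_zero] at h1
  have h2 := hx 0
  rw [zero_add, hx0] at h2
  rw [h2] at h1
  have h3 : ((y : ℝ) - ξ) * ((f y : ℝ) - ξ) = ((y : ℝ) - ξ) * (-R * (y - ξ)) := by linarith
  linarith [mul_left_cancel₀ hy0 h3]

theorem strictMono_or_strictAnti_of_injective {I : Set ℝ} (hI : I.OrdConnected)
    (hne : I.Nonempty) {f : I → I} (hf : Continuous f) (hinj : Function.Injective f) :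
    StrictMono f ∨ StrictAnti f := by
  have : Inhabited I := ⟨⟨_, hne.some_mem⟩⟩
  exact hf.strictMono_of_inj hinj

end

theorem mainTheorem1 (k n : ℕ) (hk : 0 < k) (hkn : k < n)
    (I : Set ℝ) (hI : I.OrdConnected) (hI' : I.Nontrivial)
    (f : I → I) (hf : Continuous f) (hsurj : Function.Surjective f)
    (heq : ∀ x : I, (f^[k] x : ℝ) =
      1 / ((n : ℝ) + 1) * ∑ i ∈ Finset.range (n + 1), (f^[i] x : ℝ)) :
    (Odd k → n = 2 * k → ∃ c : ℝ, ∀ x : I, (f x : ℝ) = x + c) ∧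
    (Odd k → Even n → n ≠ 2 * k → ∃ r₀ : ℝ, IsThePosRoot k n r₀ ∧ IsThreePiece f r₀) ∧
    (Odd n → ∃ rpos rneg : ℝ, IsThePosRoot k n rpos ∧ IsTheNegRoot k n rneg ∧
      ((∃ c : ℝ, ∀ x : I, (f x : ℝ) = rneg * x + c) ∨ IsThreePiece f rpos)) := by
  have h : IsMeanIterate k n f := heq
  have hbij : Function.Bijective f := ⟨h.injective hk, hsurj⟩
  have hne := hI'.nonempty
  obtain ⟨R, H, hR, hfac, hH, hH0, huniq⟩ := exists_posRoot hk hkn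
  have hmono := strictMono_or_strictAnti_of_injective hI hne hf hbij.1
  have hthree : StrictMono f → n ≠ 2 * k → IsThreePiece f R := fun hm hnk =>
    isThreePiece_of_displacement hne (hm.orderIsoOfSurjective f hsurj) hR
      (isThePosRoot_of_ne hkn hR hnk huniq).2
      (displacement_of_orderIso hkn hR hfac hH hH0 (hm.orderIsoOfSurjective f hsurj) h)
  refine ⟨fun hko hnk => ?_, fun hko hne' hnk => ?_, fun hno => ?_⟩
  · have hm := hmono.resolve_right
      (not_strictAnti_of_odd_of_even hI hI' hko (hnk ▸ even_two_mul k) hf hbij h)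
    have hR1 := posRoot_eq_one hkn hnk huniq
    refine exists_translation_of_displacement hne (hm.orderIsoOfSurjective f hsurj) fun x => ?_
    rw [displacement_of_orderIso hkn hR hfac hH hH0 (hm.orderIsoOfSurjective f hsurj) h x, hR1,
      one_mul]
  · exact ⟨R, (isThePosRoot_of_ne hkn hR hnk huniq).1, hthree (hmono.resolve_right
      (not_strictAnti_of_odd_of_even hI hI' hko hne' hf hbij h)) hnk⟩
  -- Oddness of n excludes the parabolic case, so both roots exist and monotonicity alone selects
  -- the alternative.
  · have hnk : n ≠ 2 * k := by
      rintro rfl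
      exact Nat.not_even_iff_odd.2 hno (even_two_mul k)
    obtain ⟨S, G, hS, hfacS, hG, hG0, hneg⟩ := exists_negRoot hk hkn hno
    refine ⟨R, -S, (isThePosRoot_of_ne hkn hR hnk huniq).1, hneg, ?_⟩
    rcases hmono with hm | ha
    · exact Or.inr (hthree hm hnk)
    · exact Or.inl (exists_affine_of_strictAnti hI hne hk hkn hno hS hfacS hG hG0 hf hbij h ha)
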